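/- Let $\beta>0$ and $\epsilon=(1+e^{2\beta})^{-1}$. Let $T_r=(V_r,E_r)$ be the complete rooted ternary tree with root at level $0$ and leaves at level $r$, let $n_r=|V_r|$, and let $\pi(\sigma)=\frac1Z\prod_{(v,w)\in E_r}e^{\beta\sigma(v)\sigma(w)}$ be the Ising distribution on $\{-1,+1\}^{V_r}$. For a transition matrix $P$ on $\{-1,+1\}^{V_r}$ that is reversible with respect to $\pi$, let $\lambda_2(P)$ be its second largest eigenvalue (with multiplicity) and $\tau_2(P)=1/(1-\lambda_2(P))$. Let $\lambda_2^\star$ be the minimum of $\lambda_2(P)$ over all such $P$ with $P(\sigma,\sigma')=0$ whenever $\sigma,\sigma'$ differ at more than one vertex, and let $\tau_2^\star=1/(1-\lambda_2^\star)$ be the relaxation time of the fastest mixing chain. Let $P_U$ be the Glauber dynamics with uniform rates: at each step a vertex $v\in V_r$ is picked uniformly at random and its spin is resampled from $\pi$ conditioned on the spins of the other vertices. Then, for fixed $\beta$, as $r\to\infty$, $$\tau_2^\star=\Omega\left(n_r^{-\log_3(2\epsilon+8\epsilon^2)-1}\right),$$ whereas for the uniform Glauber dynamics $$\tau_2(P_U)=\Omega\left(n_r^{-\log_3(2\epsilon+8\epsilon^2)}\right).$$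 -/

import Mathlib

noncomputable section

namespace FastestMixing

/-! Fastest mixing chains on a transition graph. -/

/-- `P` is a feasible transition matrix for the transition graph with edge relation `E` (self-loops
included in `E`) and target distribution `π`: nonnegative entries, transitions only along edges,
rows summing to one, and detailed balance with respect to `π`. -/
structure IsFeasible {X : Type*} [Fintype X] (E : X → X → Prop) (π : X → ℝ)
    (P : Matrix X X ℝ) : Prop where
  nonneg : ∀ i j, 0 ≤ P i j
  support : ∀ i j, ¬ E i j → P i j = 0
  row_sum : ∀ i, ∑ j, P i j = 1
  reversible : ∀ i j, E i j → π i * P i j = π j * P j i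

/-- The real eigenvalues of `P`, with multiplicity, in decreasing order `λ₁ ≥ λ₂ ≥ …`. (A matrix
that is reversible for a positive `π` has all its eigenvalues in `ℝ`.) -/
def sortedEigenvalues {X : Type*} [Fintype X] [DecidableEq X] (P : Matrix X X ℝ) : List ℝ :=
  P.charpoly.roots.sort (· ≥ ·)

/-- The second largest eigenvalue `λ₂(P)`, counted with multiplicity (the list is indexed from `0`;
the default value `0` is only used when there are fewer than two real eigenvalues). -/
def lambda2 {X : Type*} [Fintype X] [DecidableEq X] (P : Matrix X X ℝ) : ℝ :=
  (sortedEigenvalues P).getD 1 0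

/-- The relaxation time `τ₂(P) = 1 / (1 - λ₂(P))`. -/
def tau2 {X : Type*} [Fintype X] [DecidableEq X] (P : Matrix X X ℝ) : ℝ :=
  1 / (1 - lambda2 P)

/-- `λ₂⋆`, the least value of `λ₂(P)` over all feasible `P`. (The feasible set is compact and `λ₂` is
continuous on it, so for positive `π` the infimum is attained.) -/
def lambda2Star {X : Type*} [Fintype X] [DecidableEq X] (E : X → X → Prop) (π : X → ℝ) : ℝ :=
  sInf (lambda2 '' {P : Matrix X X ℝ | IsFeasible E π P})

/-- `τ₂⋆ = 1 / (1 - λ₂⋆)`, the relaxation time of the fastest mixing chain. -/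
def tau2Star {X : Type*} [Fintype X] [DecidableEq X] (E : X → X → Prop) (π : X → ℝ) : ℝ :=
  1 / (1 - lambda2Star E π)

/-! The Ising model on a finite graph and its Glauber dynamics. -/

/-- Configurations `σ : V → {-1, +1}`; the spins `-1, +1` are the units of `ℤ`. -/
abbrev Config (V : Type*) := V → ℤˣ

/-- The pair interaction `α(s, t) = exp(β s t)`. -/
def alpha (β : ℝ) (s t : ℤˣ) : ℝ :=
  Real.exp (β * ((s : ℤ) : ℝ) * ((t : ℤ) : ℝ))

lemma alpha_comm (β : ℝ) (s t : ℤˣ) : alpha β s t = alpha β t s := by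
  unfold alpha
  congr 1
  ring

/-- The interaction of the two endpoints of an undirected edge. -/
def edgeWeight {V : Type*} (β : ℝ) (σ : Config V) : Sym2 V → ℝ :=
  Sym2.lift ⟨fun v w => alpha β (σ v) (σ w), fun v w => alpha_comm β (σ v) (σ w)⟩

open Classical in
/-- The unnormalized Ising weight: the product of the interactions over all edges. -/
def isingWeight {V : Type*} [Fintype V] (G : SimpleGraph V) (β : ℝ) (σ : Config V) : ℝ :=
  ∏ e ∈ G.edgeFinset, edgeWeight β σ e

/-- The Ising distribution on `{-1, +1}^V`. -/
def isingMeasure {V : Type*} [Fintype V] [DecidableEq V] (G : SimpleGraph V) (β : ℝ)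
    (σ : Config V) : ℝ :=
  isingWeight G β σ / ∑ τ : Config V, isingWeight G β τ

/-- The transition graph of local dynamics: `σ` and `τ` agree at all but at most one vertex. -/
def LocalMove {V : Type*} (σ τ : Config V) : Prop :=
  {v | σ v ≠ τ v}.Subsingleton

open Classical in
/-- The local interaction of spin `a` at `v` with the neighbours of `v` in `σ`. -/
def localWeight {V : Type*} [Fintype V] (G : SimpleGraph V) (β : ℝ) (σ : Config V) (v : V)
    (a : ℤˣ) : ℝ :=
  ∏ w ∈ G.neighborFinset v, alpha β a (σ w)

/-- The probability `K(σ, σ_v^a)` that an update of `v` sets its spin to `a`. -/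
def heatBath {V : Type*} [Fintype V] (G : SimpleGraph V) (β : ℝ) (σ : Config V) (v : V)
    (a : ℤˣ) : ℝ :=
  localWeight G β σ v a / ∑ a' : ℤˣ, localWeight G β σ v a'

/-- The Glauber dynamics with rates `ρ`: pick `v` with probability `ρ v`, then update its spin. -/
def glauber {V : Type*} [Fintype V] [DecidableEq V] (G : SimpleGraph V) (β : ℝ) (ρ : V → ℝ) :
    Matrix (Config V) (Config V) ℝ :=
  Matrix.of fun σ τ =>
    ∑ v, ρ v * ∑ a : ℤˣ, if τ = Function.update σ v a then heatBath G β σ v a else 0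

/-- The Glauber dynamics with uniform rates. -/
def uniformGlauber {V : Type*} [Fintype V] [DecidableEq V] (G : SimpleGraph V) (β : ℝ) :
    Matrix (Config V) (Config V) ℝ :=
  glauber G β fun _ => 1 / (Fintype.card V : ℝ)

/-! The complete rooted `b`-ary tree. -/

/-- Vertices of the complete rooted `b`-ary tree with root at level `0` and leaves at level `r`:
words of length at most `r` over `b` letters. The root is the empty word, the level of a vertex
is its length. -/
abbrev TreeVertex (b r : ℕ) := {l : List (Fin b) // l.length ≤ r}

instance treeVertexFintype (b r : ℕ) : Fintype (TreeVertex b r) :=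
  (List.finite_length_le (Fin b) r).fintype

/-- The tree `T_r^{(b)}`: each word `u` is joined to its children `u ++ [a]`. -/
def completeTree (b r : ℕ) : SimpleGraph (TreeVertex b r) :=
  SimpleGraph.fromRel fun u v => ∃ a : Fin b, v.1 = u.1 ++ [a]

end FastestMixing

end

/-! By the variational principle (`one_sub_dirichletForm_le_lambda2`), the Dirichlet form of any
function of mean zero and variance one bounds 1 - λ₂ from above. The test function is the recursive
majority of the leaf spins, which a local move changes only by flipping a pivotal leaf
(`exists_pivotal_of_majority_ne`). A leaf is pivotal when, at each of the r branchings above it, the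
two sibling subtrees disagree. Given the spin of their parent these are independent with common mean
±m, so a branching costs a factor (1 - m²)/2. The recursion for m keeps this factor below κ = 2ε +
8ε² (`majorityMean_bounds`), so a leaf is pivotal with probability at most κ^r
(`message_pivotal_le`).

Uniform Glauber dynamics chooses its vertex independently of the configuration, so its Dirichlet
form is at most 2κ^r. An arbitrary local chain may favour pivotal spins, and a union bound over
vertices loses a factor n_r. Since n_r is comparable to 3^r, κ^r is comparable to n_r^(log₃ κ).
Taking reciprocals also requires λ₂ < 1, which follows from irreducibility (`lambda2_lt_one`). -/

noncomputable section

namespace FastestMixing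

/-! ### Spectral theory of reversible chains. -/

section Spectral

open Matrix

variable {X : Type*}

lemma eigenvectorBasis_dotProduct_mulVec [Fintype X] [DecidableEq X] {A : Matrix X X ℝ} (hA : A.IsHermitian) (i : X) (w : X → ℝ) :
    (hA.eigenvectorBasis i).ofLp ⬝ᵥ A *ᵥ w =
      hA.eigenvalues i * ((hA.eigenvectorBasis i).ofLp ⬝ᵥ w) := by
  rw [dotProduct_mulVec, ← mulVec_transpose]
  have : Aᵀ = A := by rw [← conjTranspose_eq_transpose_of_trivial]; exact hA
  rw [this, hA.mulVec_eigenvectorBasis, smul_dotProduct, smul_eq_mul]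

lemma sum_eigenvectorBasis_mul [Fintype X] [DecidableEq X] {A : Matrix X X ℝ} (hA : A.IsHermitian) (v w : X → ℝ) :
    ∑ i, ((hA.eigenvectorBasis i).ofLp ⬝ᵥ v) * ((hA.eigenvectorBasis i).ofLp ⬝ᵥ w) = v ⬝ᵥ w := by
  have := hA.eigenvectorBasis.sum_inner_mul_inner (WithLp.toLp 2 v) (WithLp.toLp 2 w)
  simp only [EuclideanSpace.inner_eq_star_dotProduct, star_trivial] at this
  rw [dotProduct_comm v w, ← this]
  refine Finset.sum_congr rfl fun i _ => ?_
  rw [dotProduct_comm w]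

/-- The second largest eigenvalue of a symmetric matrix bounds from above the minimum of the
Rayleigh quotient over a plane. -/
lemma le_second_eigenvalue [Fintype X] [DecidableEq X] {A : Matrix X X ℝ} (hA : A.IsHermitian) (hX : 1 < Fintype.card X)
    {w₁ w₂ : X → ℝ} {ρ : ℝ}
    (hne : ∀ a b : ℝ, a • w₁ + b • w₂ = 0 → a = 0 ∧ b = 0)
    (h : ∀ a b : ℝ, ρ * ((a • w₁ + b • w₂) ⬝ᵥ (a • w₁ + b • w₂)) ≤
      (a • w₁ + b • w₂) ⬝ᵥ A *ᵥ (a • w₁ + b • w₂)) :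
    ρ ≤ hA.eigenvalues₀ ⟨1, hX⟩ := by
  set e : Fin (Fintype.card X) ≃ X := Fintype.equivOfCardEq (Fintype.card_fin _) with he
  set i₀ : X := e ⟨0, by omega⟩ with hi₀
  set φ : X → ℝ := (hA.eigenvectorBasis i₀).ofLp with hφ
  -- Courant–Fischer: every plane contains a nonzero vector orthogonal to the top eigenvector.
  obtain ⟨a, b, hab, horth⟩ : ∃ a b : ℝ, ¬ (a = 0 ∧ b = 0) ∧ φ ⬝ᵥ (a • w₁ + b • w₂) = 0 := by
    by_cases hw : φ ⬝ᵥ w₁ = 0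
    · exact ⟨1, 0, by simp, by simp [hw]⟩
    · refine ⟨φ ⬝ᵥ w₂, -(φ ⬝ᵥ w₁), by simp [hw], ?_⟩
      simp only [dotProduct_add, dotProduct_smul, smul_eq_mul]
      ring
  set u := a • w₁ + b • w₂ with hu
  have hpos : 0 < u ⬝ᵥ u := by
    have h0 : u ≠ 0 := fun h0 => hab (hne a b h0)
    have := dotProduct_star_self_pos_iff.2 h0
    simpa using this
  have hle : u ⬝ᵥ A *ᵥ u ≤ hA.eigenvalues₀ ⟨1, hX⟩ * (u ⬝ᵥ u) := by
    rw [← sum_eigenvectorBasis_mul hA u u, ← sum_eigenvectorBasis_mul hA u (A *ᵥ u),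
      Finset.mul_sum]
    refine Finset.sum_le_sum fun i _ => ?_
    rw [eigenvectorBasis_dotProduct_mulVec hA]
    by_cases hi : i = i₀
    · have : (hA.eigenvectorBasis i).ofLp ⬝ᵥ u = 0 := by rw [hi]; exact horth
      simp [this]
    · have hev : hA.eigenvalues i ≤ hA.eigenvalues₀ ⟨1, hX⟩ := by
        refine hA.eigenvalues₀_antitone ?_
        have : e.symm i ≠ ⟨0, by omega⟩ := fun h => hi (by rw [hi₀, ← h, e.apply_symm_apply])
        rw [Fin.le_def]
        have h2 : (e.symm i).val ≠ 0 := fun h => this (Fin.ext h)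
        show 1 ≤ (e.symm i).val
        omega
      nlinarith [mul_le_mul_of_nonneg_right hev
        (mul_self_nonneg ((hA.eigenvectorBasis i).ofLp ⬝ᵥ u))]
  exact le_of_mul_le_mul_right ((h a b).trans hle) hpos

/-- If the second largest eigenvalue of a symmetric matrix is at least one, there are two
orthonormal vectors whose Rayleigh quotients are at least one. -/
lemma exists_orthonormal_of_one_le_second_eigenvalue [Fintype X] [DecidableEq X] {A : Matrix X X ℝ} (hA : A.IsHermitian)
    (hX : 1 < Fintype.card X) (h : 1 ≤ hA.eigenvalues₀ ⟨1, hX⟩) :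
    ∃ u v : X → ℝ, u ⬝ᵥ v = 0 ∧ u ⬝ᵥ u = 1 ∧ v ⬝ᵥ v = 1 ∧ 1 ≤ u ⬝ᵥ A *ᵥ u ∧ 1 ≤ v ⬝ᵥ A *ᵥ v := by
  set e : Fin (Fintype.card X) ≃ X := Fintype.equivOfCardEq (Fintype.card_fin _) with he
  have horth : ∀ i j, (hA.eigenvectorBasis i).ofLp ⬝ᵥ (hA.eigenvectorBasis j).ofLp =
      if i = j then 1 else 0 := by
    intro i j
    have := (orthonormal_iff_ite.1 hA.eigenvectorBasis.orthonormal) i j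
    rw [EuclideanSpace.inner_eq_star_dotProduct, star_trivial, dotProduct_comm] at this
    exact this
  have hval : ∀ k : Fin (Fintype.card X), hA.eigenvalues (e k) = hA.eigenvalues₀ k := fun k =>
    congrArg hA.eigenvalues₀ (e.symm_apply_apply k)
  refine ⟨(hA.eigenvectorBasis (e ⟨0, by omega⟩)).ofLp, (hA.eigenvectorBasis (e ⟨1, hX⟩)).ofLp,
    ?_, ?_, ?_, ?_, ?_⟩
  · rw [horth, if_neg]; simp
  · rw [horth, if_pos rfl]
  · rw [horth, if_pos rfl]
  · rw [eigenvectorBasis_dotProduct_mulVec, horth, if_pos rfl, hval, mul_one]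
    exact h.trans (hA.eigenvalues₀_antitone (by simp [Fin.le_def]))
  · rw [eigenvectorBasis_dotProduct_mulVec, horth, if_pos rfl, hval, mul_one]
    exact h

/-- A reversible matrix conjugated into a symmetric one. -/
def symmetrization (π : X → ℝ) (P : Matrix X X ℝ) : Matrix X X ℝ :=
  Matrix.of fun i j => √(π i) * P i j * (√(π j))⁻¹

variable {π : X → ℝ} {P : Matrix X X ℝ}

lemma isHermitian_symmetrization (hπ : ∀ i, 0 < π i) (hrev : ∀ i j, π i * P i j = π j * P j i) :
    (symmetrization π P).IsHermitian := by
  ext i j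
  have hi := Real.sqrt_pos.2 (hπ i)
  have hj := Real.sqrt_pos.2 (hπ j)
  have h := hrev i j
  rw [← Real.mul_self_sqrt (hπ i).le, ← Real.mul_self_sqrt (hπ j).le] at h
  simp only [symmetrization, conjTranspose_apply, of_apply, star_trivial]
  field_simp
  linarith

lemma charpoly_symmetrization [Fintype X] [DecidableEq X] (hπ : ∀ i, 0 < π i) :
    (symmetrization π P).charpoly = P.charpoly := by
  have h1 : symmetrization π P = diagonal (fun i => √(π i)) * P * diagonal (fun i => (√(π i))⁻¹) := by
    ext i j
    simp [symmetrization, mul_diagonal, diagonal_mul]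
  have h2 : diagonal (fun i => (√(π i))⁻¹) * diagonal (fun i => √(π i)) = 1 := by
    rw [diagonal_mul_diagonal, ← diagonal_one]
    congr 1
    ext i
    exact inv_mul_cancel₀ (Real.sqrt_pos.2 (hπ i)).ne'
  rw [h1, charpoly_mul_comm, ← mul_assoc, h2, one_mul]

/-- The symmetrization is similar to `P`, so its sorted eigenvalues are the sorted roots of
`P.charpoly`; having at least two states rules out the default value in `lambda2`. -/
lemma lambda2_eq_eigenvalue [Fintype X] [DecidableEq X] (hπ : ∀ i, 0 < π i) (hrev : ∀ i j, π i * P i j = π j * P j i)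
    (hX : 1 < Fintype.card X) :
    lambda2 P = (isHermitian_symmetrization hπ hrev).eigenvalues₀ ⟨1, hX⟩ := by
  have h := (isHermitian_symmetrization hπ hrev).sort_roots_charpoly_eq_eigenvalues₀
  rw [charpoly_symmetrization hπ] at h
  have h' : sortedEigenvalues P =
      List.ofFn (isHermitian_symmetrization hπ hrev).eigenvalues₀ := by
    rw [← h]
    simp [sortedEigenvalues]
  rw [lambda2, h', List.getD_eq_getElem _ _ (by simpa using hX)]
  simp

/-- The Dirichlet form of a transition matrix. -/
def dirichletForm [Fintype X] (π : X → ℝ) (P : Matrix X X ℝ) (f : X → ℝ) : ℝ :=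
  1 / 2 * ∑ i, ∑ j, π i * P i j * (f i - f j) ^ 2

lemma dirichletForm_nonneg [Fintype X] (hπ : ∀ i, 0 < π i) (hP : ∀ i j, 0 ≤ P i j) (f : X → ℝ) :
    0 ≤ dirichletForm π P f :=
  mul_nonneg (by norm_num) (Finset.sum_nonneg fun i _ => Finset.sum_nonneg fun j _ =>
    mul_nonneg (mul_nonneg (hπ i).le (hP i j)) (sq_nonneg _))

lemma dirichletForm_eq [Fintype X] (hrev : ∀ i j, π i * P i j = π j * P j i) (hrow : ∀ i, ∑ j, P i j = 1)
    (f : X → ℝ) :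
    dirichletForm π P f = ∑ i, π i * f i ^ 2 - ∑ i, ∑ j, π i * P i j * (f i * f j) := by
  have h1 : ∑ i, ∑ j, π i * P i j * f i ^ 2 = ∑ i, π i * f i ^ 2 := by
    refine Finset.sum_congr rfl fun i _ => ?_
    rw [← Finset.sum_mul, ← Finset.mul_sum, hrow, mul_one]
  have h2 : ∑ i, ∑ j, π i * P i j * f j ^ 2 = ∑ i, π i * f i ^ 2 := by
    rw [Finset.sum_comm, ← h1]
    exact Finset.sum_congr rfl fun i _ => Finset.sum_congr rfl fun j _ => by rw [hrev]
  have h3 : ∑ i, ∑ j, π i * P i j * (f i - f j) ^ 2 =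
      ∑ i, ∑ j, π i * P i j * f i ^ 2 + ∑ i, ∑ j, π i * P i j * f j ^ 2 -
        2 * ∑ i, ∑ j, π i * P i j * (f i * f j) := by
    simp only [Finset.mul_sum, ← Finset.sum_add_distrib, ← Finset.sum_sub_distrib]
    exact Finset.sum_congr rfl fun i _ => Finset.sum_congr rfl fun j _ => by ring
  rw [dirichletForm, h3, h1, h2]
  ring

lemma dotProduct_symmetrization [Fintype X] (hπ : ∀ i, 0 < π i) (f : X → ℝ) :
    (fun i => √(π i) * f i) ⬝ᵥ symmetrization π P *ᵥ (fun i => √(π i) * f i) =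
      ∑ i, ∑ j, π i * P i j * (f i * f j) := by
  simp only [dotProduct, mulVec, symmetrization, of_apply, Finset.mul_sum]
  refine Finset.sum_congr rfl fun i _ => Finset.sum_congr rfl fun j _ => ?_
  have hj := (Real.sqrt_pos.2 (hπ j)).ne'
  calc _ = (√(π i) * √(π i)) * P i j * (f i * f j) * ((√(π j))⁻¹ * √(π j)) := by ring
    _ = _ := by rw [Real.mul_self_sqrt (hπ i).le, inv_mul_cancel₀ hj, mul_one]

lemma dotProduct_sqrt_mul [Fintype X] (hπ : ∀ i, 0 < π i) (f g : X → ℝ) :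
    (fun i => √(π i) * f i) ⬝ᵥ (fun i => √(π i) * g i) = ∑ i, π i * (f i * g i) := by
  refine Finset.sum_congr rfl fun i _ => ?_
  calc _ = (√(π i) * √(π i)) * (f i * g i) := by ring
    _ = _ := by rw [Real.mul_self_sqrt (hπ i).le]

/-- The variational lower bound for the second eigenvalue of a reversible chain. -/
lemma one_sub_dirichletForm_le_lambda2 [Fintype X] [DecidableEq X] (hπ : ∀ i, 0 < π i) (hP : ∀ i j, 0 ≤ P i j)
    (hrev : ∀ i j, π i * P i j = π j * P j i) (hrow : ∀ i, ∑ j, P i j = 1)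
    (hX : 1 < Fintype.card X) (f : X → ℝ) (hmean : ∑ i, π i * f i = 0)
    (hvar : ∑ i, π i * f i ^ 2 = 1) :
    1 - dirichletForm π P f ≤ lambda2 P := by
  rw [lambda2_eq_eigenvalue hπ hrev hX]
  have hcomb : ∀ a b : ℝ, (a • fun i => √(π i) * 1) + (b • fun i => √(π i) * f i) =
      fun i => √(π i) * (a + b * f i) := by
    intro a b
    ext i
    simp only [Pi.add_apply, Pi.smul_apply, smul_eq_mul]
    ring
  have hnorm : ∀ a b : ℝ, ∑ i, π i * ((a + b * f i) * (a + b * f i)) =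
      a ^ 2 * ∑ i, π i + b ^ 2 := by
    intro a b
    calc _ = ∑ i, (a ^ 2 * π i + 2 * a * b * (π i * f i) + b ^ 2 * (π i * f i ^ 2)) :=
          Finset.sum_congr rfl fun i _ => by ring
      _ = _ := by
          rw [Finset.sum_add_distrib, Finset.sum_add_distrib, ← Finset.mul_sum, ← Finset.mul_sum,
            ← Finset.mul_sum, hmean, hvar]
          ring
  have : Nonempty X := Fintype.card_pos_iff.1 (by omega)
  have htot : 0 < ∑ i, π i := Finset.sum_pos (fun i _ => hπ i) Finset.univ_nonempty
  -- The plane consists of the functions a + b f. There the squared norm is a² ∑ π + b² and the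
  -- quadratic form is a² ∑ π + b² (1 - D), with D the Dirichlet form of f.
  refine le_second_eigenvalue _ hX (w₁ := fun i => √(π i) * 1) (w₂ := fun i => √(π i) * f i) ?_ ?_
  · intro a b h
    rw [hcomb] at h
    have h1 := dotProduct_sqrt_mul hπ (fun i => a + b * f i) (fun i => a + b * f i)
    rw [h, hnorm] at h1
    simp only [dotProduct_zero] at h1
    have ha : a ^ 2 * ∑ i, π i = 0 := by nlinarith [mul_nonneg (sq_nonneg a) htot.le, sq_nonneg b]
    have hb : b ^ 2 = 0 := by nlinarith [mul_nonneg (sq_nonneg a) htot.le, sq_nonneg b]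
    exact ⟨by simpa [htot.ne'] using ha, by simpa using hb⟩
  · intro a b
    rw [hcomb, dotProduct_sqrt_mul hπ, dotProduct_symmetrization hπ, hnorm]
    have h1 := dirichletForm_eq hrev hrow (fun i => a + b * f i)
    have h2 : dirichletForm π P (fun i => a + b * f i) = b ^ 2 * dirichletForm π P f := by
      simp only [dirichletForm, Finset.mul_sum]
      exact Finset.sum_congr rfl fun i _ => Finset.sum_congr rfl fun j _ => by ring
    have h3 : ∑ i, π i * (a + b * f i) ^ 2 = a ^ 2 * ∑ i, π i + b ^ 2 := by
      rw [← hnorm]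
      exact Finset.sum_congr rfl fun i _ => by ring
    have h4 := dirichletForm_nonneg hπ hP f
    nlinarith [mul_nonneg (mul_nonneg (sq_nonneg a) htot.le) h4]

/-- An irreducible reversible chain has a spectral gap. -/
lemma lambda2_lt_one [Fintype X] [DecidableEq X] (hπ : ∀ i, 0 < π i) (hP : ∀ i j, 0 ≤ P i j)
    (hrev : ∀ i j, π i * P i j = π j * P j i) (hrow : ∀ i, ∑ j, P i j = 1)
    (hX : 1 < Fintype.card X)
    (hirr : ∀ f : X → ℝ, (∀ i j, 0 < P i j → f i = f j) → ∀ i j, f i = f j) :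
    lambda2 P < 1 := by
  rw [lambda2_eq_eigenvalue hπ hrev hX]
  by_contra! hge
  obtain ⟨u, v, huv, hu, hv, hAu, hAv⟩ :=
    exists_orthonormal_of_one_le_second_eigenvalue _ hX hge
  have hsq : ∀ i, √(π i) ≠ 0 := fun i => (Real.sqrt_pos.2 (hπ i)).ne'
  -- A Rayleigh quotient of at least one makes the Dirichlet form vanish, so irreducibility forces
  -- the function to be constant.
  have key : ∀ w : X → ℝ, w ⬝ᵥ w = 1 → 1 ≤ w ⬝ᵥ symmetrization π P *ᵥ w →
      ∃ c, w = fun i => √(π i) * c := by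
    intro w hw hAw
    set f : X → ℝ := fun i => w i / √(π i) with hf
    have hwf : w = fun i => √(π i) * f i := by
      ext i
      rw [hf, mul_div_cancel₀ _ (hsq i)]
    rw [hwf, dotProduct_sqrt_mul hπ] at hw
    rw [hwf, dotProduct_symmetrization hπ] at hAw
    have hD : dirichletForm π P f ≤ 0 := by
      rw [dirichletForm_eq hrev hrow]
      simp only [pow_two]
      linarith
    have hterm : ∀ i j, 0 ≤ π i * P i j * (f i - f j) ^ 2 := fun i j =>
      mul_nonneg (mul_nonneg (hπ i).le (hP i j)) (sq_nonneg _)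
    have hconst := hirr f fun i j hij => by
      have h1 : π i * P i j * (f i - f j) ^ 2 ≤ 0 := by
        have h2 : π i * P i j * (f i - f j) ^ 2 ≤ ∑ j, π i * P i j * (f i - f j) ^ 2 :=
          Finset.single_le_sum (f := fun j => π i * P i j * (f i - f j) ^ 2)
            (fun j _ => hterm i j) (Finset.mem_univ j)
        have h3 := Finset.single_le_sum (f := fun i => ∑ j, π i * P i j * (f i - f j) ^ 2)
            (fun i _ => Finset.sum_nonneg fun j _ => hterm i j) (Finset.mem_univ i)
        simp only [dirichletForm] at hD
        linarith
      have h2 := mul_pos (hπ i) hij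
      have h3 : (f i - f j) ^ 2 = 0 := by nlinarith [sq_nonneg (f i - f j)]
      exact sub_eq_zero.1 (pow_eq_zero_iff two_ne_zero |>.1 h3)
    have : Nonempty X := Fintype.card_pos_iff.1 (by omega)
    refine ⟨f (Classical.arbitrary X), ?_⟩
    rw [hwf]
    ext i
    rw [hconst i (Classical.arbitrary X)]
  obtain ⟨c, rfl⟩ := key u hu hAu
  obtain ⟨d, rfl⟩ := key v hv hAv
  rw [dotProduct_sqrt_mul hπ, ← Finset.sum_mul] at huv hu hv
  -- Multiples of the same vector give equality in Cauchy–Schwarz, against orthonormality.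
  have h0 : (∑ i, π i) * (c * c) * ((∑ i, π i) * (d * d)) = 0 := by
    calc _ = ((∑ i, π i) * (c * d)) * ((∑ i, π i) * (c * d)) := by ring
      _ = 0 := by rw [huv, zero_mul]
  rw [hu, hv] at h0
  norm_num at h0

end Spectral

/-! ### Glauber dynamics: reversibility and irreducibility. -/

section Glauber

variable {V : Type*} [Fintype V] (G : SimpleGraph V) (β : ℝ)

lemma alpha_pos (s t : ℤˣ) : 0 < alpha β s t := Real.exp_pos _

lemma edgeWeight_pos {V : Type*} (σ : Config V) (e : Sym2 V) : 0 < edgeWeight β σ e := by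
  induction e with
  | _ v w => exact alpha_pos β _ _

lemma isingWeight_pos (σ : Config V) : 0 < isingWeight G β σ :=
  Finset.prod_pos fun e _ => edgeWeight_pos β σ e

lemma localWeight_pos (σ : Config V) (v : V) (a : ℤˣ) : 0 < localWeight G β σ v a :=
  Finset.prod_pos fun _ _ => alpha_pos β _ _

lemma heatBath_pos (σ : Config V) (v : V) (a : ℤˣ) : 0 < heatBath G β σ v a :=
  div_pos (localWeight_pos G β σ v a)
    (Finset.sum_pos (fun _ _ => localWeight_pos G β σ v _) Finset.univ_nonempty)

lemma sum_heatBath (σ : Config V) (v : V) : ∑ a, heatBath G β σ v a = 1 := by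
  simp only [heatBath]
  rw [← Finset.sum_div, div_self]
  exact (Finset.sum_pos (fun _ _ => localWeight_pos G β σ v _) Finset.univ_nonempty).ne'

variable [DecidableEq V]

lemma sum_isingWeight_pos : 0 < ∑ τ : Config V, isingWeight G β τ :=
  Finset.sum_pos (fun _ _ => isingWeight_pos G β _) Finset.univ_nonempty

lemma isingMeasure_pos (σ : Config V) : 0 < isingMeasure G β σ :=
  div_pos (isingWeight_pos G β σ) (sum_isingWeight_pos G β)

lemma sum_isingMeasure : ∑ σ, isingMeasure G β σ = 1 := by
  simp only [isingMeasure]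
  rw [← Finset.sum_div, div_self (sum_isingWeight_pos G β).ne']

lemma localWeight_update (σ : Config V) (v : V) (a b : ℤˣ) :
    localWeight G β (Function.update σ v b) v a = localWeight G β σ v a := by
  refine Finset.prod_congr rfl fun w hw => ?_
  have : w ≠ v := by
    rintro rfl
    simp at hw
  rw [Function.update_of_ne this]

lemma heatBath_update (σ : Config V) (v : V) (a b : ℤˣ) :
    heatBath G β (Function.update σ v b) v a = heatBath G β σ v a := by
  simp only [heatBath, localWeight_update]

-- Only the edges at v see its spin; the remaining factor is unaffected by an update at v, which
-- yields detailed balance.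
open Classical in
lemma isingWeight_eq_localWeight_mul (σ : Config V) (v : V) :
    isingWeight G β σ =
      localWeight G β σ v (σ v) * ∏ e ∈ G.edgeFinset with v ∉ e, edgeWeight β σ e := by
  have himg : (G.edgeFinset.filter fun e => v ∈ e) = (G.neighborFinset v).image fun w => s(v, w) := by
    ext e
    simp only [Finset.mem_filter, Finset.mem_image, SimpleGraph.mem_edgeFinset,
      SimpleGraph.mem_neighborFinset]
    constructor
    · rintro ⟨he, hv⟩
      obtain ⟨w, rfl⟩ := hv
      exact ⟨w, he, rfl⟩
    · rintro ⟨w, hw, rfl⟩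
      exact ⟨hw, Sym2.mem_mk_left v w⟩
  rw [isingWeight, ← Finset.prod_filter_mul_prod_filter_not _ (fun e => v ∈ e), himg,
    Finset.prod_image fun w _ w' _ h => Sym2.congr_right.1 h]
  rfl

open Classical in
lemma prod_edgeWeight_update (σ : Config V) (v : V) (a : ℤˣ) :
    ∏ e ∈ G.edgeFinset with v ∉ e, edgeWeight β (Function.update σ v a) e =
      ∏ e ∈ G.edgeFinset with v ∉ e, edgeWeight β σ e := by
  refine Finset.prod_congr rfl fun e he => ?_
  replace he := (Finset.mem_filter.1 he).2
  induction e with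
  | _ x y =>
    rw [Sym2.mem_iff, not_or] at he
    simp only [edgeWeight, Sym2.lift_mk]
    rw [Function.update_of_ne (Ne.symm he.1), Function.update_of_ne (Ne.symm he.2)]

/-- Detailed balance for a single spin update. -/
lemma isingMeasure_mul_heatBath (σ : Config V) (v : V) (a : ℤˣ) :
    isingMeasure G β σ * heatBath G β σ v a =
      isingMeasure G β (Function.update σ v a) * heatBath G β (Function.update σ v a) v (σ v) := by
  rw [heatBath_update]
  simp only [isingMeasure, heatBath]
  rw [isingWeight_eq_localWeight_mul G β σ v,
    isingWeight_eq_localWeight_mul G β (Function.update σ v a) v, localWeight_update,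
    prod_edgeWeight_update, Function.update_self]
  ring

lemma glauber_apply (ρ : V → ℝ) (σ τ : Config V) :
    glauber G β ρ σ τ =
      ∑ v, ρ v * if τ = Function.update σ v (τ v) then heatBath G β σ v (τ v) else 0 := by
  simp only [glauber, Matrix.of_apply]
  refine Finset.sum_congr rfl fun v _ => ?_
  congr 1
  rw [Finset.sum_eq_single (τ v)]
  · intro a _ ha
    rw [if_neg]
    intro h
    apply ha
    rw [h, Function.update_self]
  · exact fun h => absurd (Finset.mem_univ _) h

lemma sum_glauber_mul (ρ : V → ℝ) (σ : Config V) (F : Config V → ℝ) :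
    ∑ τ, glauber G β ρ σ τ * F τ =
      ∑ v, ρ v * ∑ a, heatBath G β σ v a * F (Function.update σ v a) := by
  simp only [glauber, Matrix.of_apply, Finset.sum_mul, Finset.mul_sum]
  rw [Finset.sum_comm]
  refine Finset.sum_congr rfl fun v _ => ?_
  rw [Finset.sum_comm]
  refine Finset.sum_congr rfl fun a _ => ?_
  rw [Finset.sum_eq_single (Function.update σ v a)]
  · simp [mul_assoc]
  · intro τ _ h
    simp [h]
  · simp

lemma isFeasible_glauber {ρ : V → ℝ} (hρ : ∀ v, 0 ≤ ρ v) (hsum : ∑ v, ρ v = 1) :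
    IsFeasible LocalMove (isingMeasure G β) (glauber G β ρ) where
  nonneg σ τ := by
    rw [glauber_apply]
    refine Finset.sum_nonneg fun v _ => mul_nonneg (hρ v) ?_
    split_ifs
    exacts [(heatBath_pos G β σ v _).le, le_rfl]
  support σ τ h := by
    rw [glauber_apply]
    refine Finset.sum_eq_zero fun v _ => ?_
    rw [if_neg, mul_zero]
    intro hτ
    apply h
    have : ∀ w, σ w ≠ τ w → w = v := by
      intro w hw
      by_contra hne
      apply hw
      rw [hτ, Function.update_of_ne hne]
    intro x hx y hy
    rw [this x hx, this y hy]
  row_sum σ := by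
    have h := sum_glauber_mul G β ρ σ (fun _ => 1)
    simpa only [mul_one, sum_heatBath, hsum] using h
  reversible σ τ _ := by
    rw [glauber_apply, glauber_apply, Finset.mul_sum, Finset.mul_sum]
    refine Finset.sum_congr rfl fun v _ => ?_
    by_cases h : τ = Function.update σ v (τ v)
    · have h' : σ = Function.update τ v (σ v) := by
        rw [h, Function.update_idem, Function.update_eq_self]
      have hb := isingMeasure_mul_heatBath G β σ v (τ v)
      rw [← h] at hb
      rw [if_pos h, if_pos h', mul_left_comm, hb, mul_left_comm]
    · have h' : σ ≠ Function.update τ v (σ v) := by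
        intro h'
        apply h
        rw [h', Function.update_idem, Function.update_eq_self]
      rw [if_neg h, if_neg h', mul_zero, mul_zero, mul_zero]

/-- Feasibility asks for balance along edges only, but `LocalMove` is symmetric, so off the edges
both sides vanish. -/
lemma IsFeasible.detailed_balance {V : Type*} [Fintype V] [DecidableEq V] {π : Config V → ℝ}
    {P : Matrix (Config V) (Config V) ℝ} (hP : IsFeasible LocalMove π P) (σ τ : Config V) :
    π σ * P σ τ = π τ * P τ σ := by
  by_cases h : LocalMove σ τ
  · exact hP.reversible σ τ h
  · have h' : ¬ LocalMove τ σ := by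
      simpa only [LocalMove, ne_comm] using h
    rw [hP.support σ τ h, hP.support τ σ h', mul_zero, mul_zero]

lemma glauber_update_pos {ρ : V → ℝ} (hρ : ∀ v, 0 < ρ v) (σ : Config V) (v : V) (a : ℤˣ) :
    0 < glauber G β ρ σ (Function.update σ v a) := by
  rw [glauber_apply]
  refine Finset.sum_pos' (fun w _ => mul_nonneg (hρ w).le ?_) ⟨v, Finset.mem_univ v, ?_⟩
  · split_ifs
    exacts [(heatBath_pos G β σ w _).le, le_rfl]
  · rw [Function.update_self, if_pos rfl]
    exact mul_pos (hρ v) (heatBath_pos G β σ v a)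

/-- Irreducibility: one configuration is turned into the other by changing the spins one vertex at a
time. -/
lemma eq_of_forall_update_eq {V : Type*} [Fintype V] [DecidableEq V] {f : Config V → ℝ}
    (hf : ∀ σ v a, f σ = f (Function.update σ v a)) (σ τ : Config V) : f σ = f τ := by
  have h : ∀ s : Finset V, f σ = f (s.piecewise τ σ) := by
    intro s
    induction s using Finset.induction_on with
    | empty => simp
    | insert v s _ ih => rw [Finset.piecewise_insert, ← hf, ih]
  simpa using h Finset.univ

lemma lambda2_glauber_lt_one [Nonempty V] {ρ : V → ℝ} (hρ : ∀ v, 0 < ρ v) (hsum : ∑ v, ρ v = 1) :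
    lambda2 (glauber G β ρ) < 1 := by
  have hfeas := isFeasible_glauber G β (fun v => (hρ v).le) hsum
  have : Nontrivial ℤˣ := ⟨1, -1, by decide⟩
  have hcard : 1 < Fintype.card (Config V) := Fintype.one_lt_card
  exact lambda2_lt_one (isingMeasure_pos G β) hfeas.nonneg hfeas.detailed_balance hfeas.row_sum
    hcard fun f hf => eq_of_forall_update_eq fun σ v a => hf _ _ (glauber_update_pos G β hρ σ v a)

end Glauber

/-! ### Recursive structure of the tree and of its Ising weight. -/

section Tree

namespace TreeVertex

/-- The root of the complete tree. -/
def root (b r : ℕ) : TreeVertex b r := ⟨[], Nat.zero_le r⟩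

/-- The copy of the vertex `v` in the subtree below the child `a` of the root. -/
def cons {b r : ℕ} (a : Fin b) (v : TreeVertex b r) : TreeVertex b (r + 1) :=
  ⟨a :: v.1, by simpa using v.2⟩

/-- The parent of a vertex; the root is its own parent. -/
def parent {b r : ℕ} (v : TreeVertex b r) : TreeVertex b r :=
  ⟨v.1.dropLast, by rw [List.length_dropLast]; exact (Nat.sub_le _ _).trans v.2⟩

/-- A vertex of the complete tree is the root or lies in one of the subtrees below the root. -/
def optionEquiv (b r : ℕ) : Option (Fin b × TreeVertex b r) ≃ TreeVertex b (r + 1) where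
  toFun
    | none => root b (r + 1)
    | some (a, v) => cons a v
  invFun
    | ⟨[], _⟩ => none
    | ⟨a :: l, h⟩ => some (a, ⟨l, by simpa using h⟩)
  left_inv x := by
    rcases x with _ | ⟨a, v⟩ <;> rfl
  right_inv v := by
    rcases v with ⟨_ | ⟨a, l⟩, h⟩ <;> rfl

lemma eq_root {b r : ℕ} {v : TreeVertex b r} : v.1 = [] ↔ v = root b r :=
  ⟨fun h => Subtype.ext h, fun h => by rw [h]; rfl⟩

lemma cons_injective {b r : ℕ} {a a' : Fin b} {v v' : TreeVertex b r}
    (h : cons a v = cons a' v') : a = a' ∧ v = v' := by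
  have h' := congrArg Subtype.val h
  simp only [cons, List.cons.injEq] at h'
  exact ⟨h'.1, Subtype.ext h'.2⟩

lemma card_succ (b r : ℕ) :
    Fintype.card (TreeVertex b (r + 1)) = b * Fintype.card (TreeVertex b r) + 1 := by
  rw [← Fintype.card_congr (optionEquiv b r), Fintype.card_option, Fintype.card_prod,
    Fintype.card_fin]

instance unique_zero (b : ℕ) : Unique (TreeVertex b 0) where
  default := root b 0
  uniq v := eq_root.1 (List.length_eq_zero_iff.1 (Nat.le_zero.1 v.2))

lemma two_mul_card_add_one (r : ℕ) : 2 * Fintype.card (TreeVertex 3 r) + 1 = 3 ^ (r + 1) := by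
  induction r with
  | zero => rw [Fintype.card_unique]; rfl
  | succ r ih => rw [card_succ, pow_succ, ← ih]; ring

end TreeVertex

open TreeVertex

lemma completeTree_adj_parent {b r : ℕ} {v : TreeVertex b r} (hv : v.1 ≠ []) :
    (completeTree b r).Adj (parent v) v := by
  rw [completeTree, SimpleGraph.fromRel_adj]
  refine ⟨fun h => ?_, Or.inl ⟨v.1.getLast hv, (List.dropLast_append_getLast hv).symm⟩⟩
  have h' := congrArg (fun u : TreeVertex b r => u.1.length) h
  have := List.length_pos_iff.2 hv
  simp only [parent, List.length_dropLast] at h'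
  omega

open Classical in
lemma completeTree_edgeFinset (b r : ℕ) :
    (completeTree b r).edgeFinset =
      (Finset.univ.filter fun v : TreeVertex b r => v.1 ≠ []).image fun v => s(parent v, v) := by
  ext e
  simp only [SimpleGraph.mem_edgeFinset, Finset.mem_image, Finset.mem_filter, Finset.mem_univ,
    true_and]
  constructor
  · have key : ∀ u v : TreeVertex b r, (∃ a : Fin b, v.1 = u.1 ++ [a]) → v.1 ≠ [] ∧ parent v = u := by
      rintro u v ⟨a, h⟩
      exact ⟨by simp [h], Subtype.ext (by simp [parent, h])⟩
    induction e with
    | _ u v =>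
      intro h
      rw [SimpleGraph.mem_edgeSet, completeTree, SimpleGraph.fromRel_adj] at h
      rcases h.2 with h | h
      · obtain ⟨hv, rfl⟩ := key _ _ h
        exact ⟨v, hv, rfl⟩
      · obtain ⟨hu, rfl⟩ := key _ _ h
        exact ⟨u, hu, Sym2.eq_swap⟩
  · rintro ⟨v, hv, rfl⟩
    exact completeTree_adj_parent hv

/-- The Ising weight on the tree as a product over the vertices other than the root. -/
lemma isingWeight_completeTree (b r : ℕ) (β : ℝ) (σ : Config (TreeVertex b r)) :
    isingWeight (completeTree b r) β σ =
      ∏ v : TreeVertex b r, if v.1 = [] then 1 else alpha β (σ (parent v)) (σ v) := by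
  classical
  rw [isingWeight, completeTree_edgeFinset, Finset.prod_image]
  · rw [Finset.prod_filter]
    refine Finset.prod_congr rfl fun v _ => ?_
    by_cases hv : v.1 = [] <;> simp [hv, edgeWeight]
  · intro v hv w hw h
    simp only [Finset.coe_filter, Finset.mem_univ, true_and, Set.mem_ofPred_eq] at hv hw
    rcases Sym2.eq_iff.1 h with h | h
    · exact h.2
    -- In the swapped case each vertex would be the parent of the other, which the word lengths
    -- exclude.
    · have h1 := congrArg (fun u : TreeVertex b r => u.1.length) h.1
      have h2 := congrArg (fun u : TreeVertex b r => u.1.length) h.2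
      have := List.length_pos_iff.2 hv
      simp only [parent, List.length_dropLast] at h1 h2
      omega

namespace Config

/-- The restriction of a configuration to the subtree below the child `a` of the root. -/
def sub {b r : ℕ} (σ : Config (TreeVertex b (r + 1))) (a : Fin b) : Config (TreeVertex b r) :=
  fun v => σ (cons a v)

/-- A configuration consists of the spin at the root and of the configurations on the subtrees. -/
def treeEquiv (b r : ℕ) :
    Config (TreeVertex b (r + 1)) ≃ ℤˣ × (Fin b → Config (TreeVertex b r)) where
  toFun σ := (σ (root b (r + 1)), σ.sub)
  invFun p v := ((optionEquiv b r).symm v).elim p.1 fun x => p.2 x.1 x.2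
  left_inv σ := by
    funext v
    rcases v with ⟨_ | ⟨a, l⟩, h⟩ <;> rfl
  right_inv p := rfl

end Config

lemma isingWeight_completeTree_succ (b r : ℕ) (β : ℝ) (σ : Config (TreeVertex b (r + 1))) :
    isingWeight (completeTree b (r + 1)) β σ =
      ∏ a, (alpha β (σ (root b (r + 1))) (σ.sub a (root b r)) *
        isingWeight (completeTree b r) β (σ.sub a)) := by
  rw [isingWeight_completeTree, ← (optionEquiv b r).prod_comp, Fintype.prod_option,
    Fintype.prod_prod_type]
  have h0 : ((optionEquiv b r) none).1 = [] := rfl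
  rw [if_pos h0, one_mul]
  refine Finset.prod_congr rfl fun a _ => ?_
  have h1 : alpha β (σ (root b (r + 1))) (σ.sub a (root b r)) =
      ∏ v : TreeVertex b r, if v = root b r then
        alpha β (σ (root b (r + 1))) (σ.sub a v) else 1 := by
    rw [Finset.prod_ite_eq' Finset.univ (root b r), if_pos (Finset.mem_univ _)]
  rw [isingWeight_completeTree, h1, ← Finset.prod_mul_distrib]
  refine Finset.prod_congr rfl fun v _ => ?_
  rw [if_neg (show ¬ ((optionEquiv b r) (some (a, v))).1 = [] from List.cons_ne_nil _ _)]
  by_cases hv : v.1 = []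
  · rw [if_pos hv, if_pos (eq_root.1 hv), mul_one]
    have : parent (optionEquiv b r (some (a, v))) = root b (r + 1) := by
      apply Subtype.ext
      show (a :: v.1).dropLast = []
      rw [hv]; rfl
    rw [this]
    rfl
  · rw [if_neg hv, if_neg (fun h => hv (eq_root.2 h)), one_mul]
    have : parent (optionEquiv b r (some (a, v))) = cons a (parent v) :=
      Subtype.ext (List.dropLast_cons_of_ne_nil hv)
    rw [this]
    rfl

/-- The sum of `F` over the configurations of the tree, weighted by the Ising weight of the tree
whose root is attached to a further vertex of spin `s`. -/
def message (b r : ℕ) (β : ℝ) (F : Config (TreeVertex b r) → ℝ) (s : ℤˣ) : ℝ :=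
  ∑ σ, alpha β s (σ (root b r)) * isingWeight (completeTree b r) β σ * F σ

lemma message_zero (b : ℕ) (β : ℝ) (F : Config (TreeVertex b 0) → ℝ) (s : ℤˣ) :
    message b 0 β F s = ∑ t, alpha β s t * F fun _ => t := by
  rw [message, ← (Equiv.funUnique (TreeVertex b 0) ℤˣ).symm.sum_comp]
  refine Finset.sum_congr rfl fun t _ => ?_
  have : isingWeight (completeTree b 0) β ((Equiv.funUnique (TreeVertex b 0) ℤˣ).symm t) = 1 := by
    rw [isingWeight_completeTree, Fintype.prod_unique]
    rfl
  rw [this, mul_one]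
  rfl

/-- The Markov property of the tree: once the root spin t is fixed, the subtrees are independent. -/
lemma message_succ (b r : ℕ) (β : ℝ) (F : Fin b → Config (TreeVertex b r) → ℝ) (s : ℤˣ) :
    message b (r + 1) β (fun σ => ∏ a, F a (σ.sub a)) s =
      ∑ t, alpha β s t * ∏ a, message b r β (F a) t := by
  rw [message, ← (Config.treeEquiv b r).symm.sum_comp, Fintype.sum_prod_type]
  refine Finset.sum_congr rfl fun t _ => ?_
  simp only [message]
  rw [Finset.prod_univ_sum, Fintype.piFinset_univ, Finset.mul_sum]
  refine Finset.sum_congr rfl fun S _ => ?_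
  rw [isingWeight_completeTree_succ, mul_assoc, ← Finset.prod_mul_distrib]
  rfl

lemma message_nonneg {b r : ℕ} {β : ℝ} {F : Config (TreeVertex b r) → ℝ} (h : ∀ σ, 0 ≤ F σ)
    (s : ℤˣ) : 0 ≤ message b r β F s :=
  Finset.sum_nonneg fun σ _ => mul_nonneg
    (mul_nonneg (alpha_pos β _ _).le (isingWeight_pos _ β σ).le) (h σ)

lemma message_add {b r : ℕ} {β : ℝ} (F G : Config (TreeVertex b r) → ℝ) (s : ℤˣ) :
    message b r β (fun σ => F σ + G σ) s = message b r β F s + message b r β G s := by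
  simp only [message, mul_add, Finset.sum_add_distrib]

lemma message_sub {b r : ℕ} {β : ℝ} (F G : Config (TreeVertex b r) → ℝ) (s : ℤˣ) :
    message b r β (fun σ => F σ - G σ) s = message b r β F s - message b r β G s := by
  simp only [message, mul_sub, Finset.sum_sub_distrib]

lemma message_div {b r : ℕ} {β : ℝ} (F : Config (TreeVertex b r) → ℝ) (c : ℝ) (s : ℤˣ) :
    message b r β (fun σ => F σ / c) s = message b r β F s / c := by
  simp only [message, mul_div_assoc', Finset.sum_div]

/-- The total weight of a single bond. -/
def bondWeight (β : ℝ) : ℝ := Real.exp β + Real.exp (-β)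

lemma bondWeight_pos (β : ℝ) : 0 < bondWeight β := add_pos (Real.exp_pos _) (Real.exp_pos _)

/-- The mean of a spin conditioned on a neighbouring spin `+1`. -/
def bondMean (β : ℝ) : ℝ := (Real.exp β - Real.exp (-β)) / bondWeight β

lemma sum_spin (f : ℤˣ → ℝ) : ∑ t, f t = f 1 + f (-1) := by
  rw [show (Finset.univ : Finset ℤˣ) = {1, -1} from rfl, Finset.sum_pair (by decide)]

lemma sum_alpha (β : ℝ) (s : ℤˣ) : ∑ t, alpha β s t = bondWeight β := by
  rw [sum_spin]
  rcases Int.units_eq_one_or s with rfl | rfl <;> simp [alpha, bondWeight, add_comm]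

lemma sum_alpha_mul_spin (β : ℝ) (s : ℤˣ) :
    ∑ t, alpha β s t * ((t : ℤ) : ℝ) = ((s : ℤ) : ℝ) * bondWeight β * bondMean β := by
  rw [sum_spin, bondMean, mul_assoc, mul_div_cancel₀ _ (bondWeight_pos β).ne']
  rcases Int.units_eq_one_or s with rfl | rfl <;> simp [alpha] <;> ring

lemma sum_message {b r : ℕ} {β : ℝ} (F : Config (TreeVertex b r) → ℝ) :
    ∑ s, message b r β F s =
      bondWeight β * ∑ σ, isingWeight (completeTree b r) β σ * F σ := by
  simp only [message]
  rw [Finset.sum_comm, Finset.mul_sum]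
  refine Finset.sum_congr rfl fun σ _ => ?_
  rw [← sum_alpha β (σ (root b r)), Finset.sum_mul]
  refine Finset.sum_congr rfl fun s _ => ?_
  rw [alpha_comm]
  ring

end Tree

/-! ### Recursive majority and the probability that a leaf is pivotal. -/

section Majority

open TreeVertex

/-- Cyclic indexing singles out a child with siblings a + 1 and a + 2, without a case split on a. -/
lemma prod_fin_three_shift {M : Type*} [CommMonoid M] (a : Fin 3) (f : Fin 3 → M) :
    ∏ i, f i = f a * f (a + 1) * f (a + 2) := by
  rw [← Equiv.prod_comp (Equiv.addLeft a) f, Fin.prod_univ_three]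
  simp

lemma message_succ_three (r : ℕ) (β : ℝ) (a : Fin 3) (F₀ F₁ F₂ : Config (TreeVertex 3 r) → ℝ)
    (s : ℤˣ) :
    message 3 (r + 1) β (fun σ => F₀ (σ.sub a) * F₁ (σ.sub (a + 1)) * F₂ (σ.sub (a + 2))) s =
      ∑ t, alpha β s t *
        (message 3 r β F₀ t * message 3 r β F₁ t * message 3 r β F₂ t) := by
  have h := message_succ 3 r β (fun i => if i = a then F₀ else if i = a + 1 then F₁ else F₂) s
  have h1 : a + 1 ≠ a := by simp
  have h2 : a + 2 ≠ a := by simp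
  have h3 : a + 2 ≠ a + 1 := by simp
  simpa only [prod_fin_three_shift a, if_true, if_neg h1, if_neg h2, if_neg h3] using h

/-- The recursive majority of the spins at the leaves. -/
def majority : (r : ℕ) → Config (TreeVertex 3 r) → ℝ
  | 0, σ => ((σ (root 3 0) : ℤ) : ℝ)
  | r + 1, σ =>
    -- For signs x, y, z the majority is (x + y + z - xyz)/2; being multilinear, it can be averaged
    -- over independent subtrees.
    (majority r (σ.sub 0) + majority r (σ.sub 1) + majority r (σ.sub 2) -
      majority r (σ.sub 0) * majority r (σ.sub 1) * majority r (σ.sub 2)) / 2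

lemma majority_eq_one_or : ∀ (r : ℕ) (σ : Config (TreeVertex 3 r)),
    majority r σ = 1 ∨ majority r σ = -1
  | 0, σ => by
    rcases Int.units_eq_one_or (σ (root 3 0)) with h | h <;> simp [majority, h]
  | r + 1, σ => by
    rw [majority]
    rcases majority_eq_one_or r (σ.sub 0) with h0 | h0 <;>
    rcases majority_eq_one_or r (σ.sub 1) with h1 | h1 <;>
    rcases majority_eq_one_or r (σ.sub 2) with h2 | h2 <;>
    rw [h0, h1, h2] <;> norm_num

/-- The indicator that the recursive majority depends on the spin at the leaf `l`; it vanishes for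
words `l` that are too short to be a leaf. -/
def pivotal : (r : ℕ) → List (Fin 3) → Config (TreeVertex 3 r) → ℝ
  | 0, _, _ => 1
  | _ + 1, [], _ => 0
  | r + 1, a :: l, σ =>
    -- For signs, (1 - xy)/2 is the indicator that the siblings disagree.
    pivotal r l (σ.sub a) * ((1 - majority r (σ.sub (a + 1)) * majority r (σ.sub (a + 2))) / 2)

lemma pivotal_nonneg : ∀ (r : ℕ) (l : List (Fin 3)) (σ : Config (TreeVertex 3 r)),
    0 ≤ pivotal r l σ
  | 0, _, _ => zero_le_one
  | _ + 1, [], _ => le_rfl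
  | r + 1, a :: l, σ => by
    rw [pivotal]
    refine mul_nonneg (pivotal_nonneg r l _) ?_
    rcases majority_eq_one_or r (σ.sub (a + 1)) with h1 | h1 <;>
    rcases majority_eq_one_or r (σ.sub (a + 2)) with h2 | h2 <;>
    rw [h1, h2] <;> norm_num

lemma majority_succ_shift (r : ℕ) (a : Fin 3) (σ : Config (TreeVertex 3 (r + 1))) :
    majority (r + 1) σ =
      (majority r (σ.sub a) + majority r (σ.sub (a + 1)) + majority r (σ.sub (a + 2)) -
        majority r (σ.sub a) * majority r (σ.sub (a + 1)) * majority r (σ.sub (a + 2))) / 2 := by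
  rw [majority]
  fin_cases a
  · rfl
  · show _ = (majority r (σ.sub 1) + majority r (σ.sub 2) + majority r (σ.sub 0) -
      majority r (σ.sub 1) * majority r (σ.sub 2) * majority r (σ.sub 0)) / 2
    ring
  · show _ = (majority r (σ.sub 2) + majority r (σ.sub 0) + majority r (σ.sub 1) -
      majority r (σ.sub 2) * majority r (σ.sub 0) * majority r (σ.sub 1)) / 2
    ring

/-- A local move that changes the recursive majority flips a pivotal spin. -/
lemma exists_pivotal_of_majority_ne : ∀ (r : ℕ) {σ τ : Config (TreeVertex 3 r)},
    LocalMove σ τ → majority r σ ≠ majority r τ →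
      ∃ v : TreeVertex 3 r, σ v ≠ τ v ∧ pivotal r v.1 σ = 1
  | 0, σ, τ, _, h => ⟨root 3 0, fun h' => h (by simp only [majority, h']), rfl⟩
  | r + 1, σ, τ, hl, h => by
    obtain ⟨a, ha⟩ : ∃ a, majority r (σ.sub a) ≠ majority r (τ.sub a) := by
      by_contra! h'
      exact h (by simp only [majority, h'])
    have hla : LocalMove (σ.sub a) (τ.sub a) := fun x hx y hy =>
      (cons_injective (hl (show σ (cons a x) ≠ τ (cons a x) from hx)
        (show σ (cons a y) ≠ τ (cons a y) from hy))).2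
    obtain ⟨v, hv, hp⟩ := exists_pivotal_of_majority_ne r hla ha
    refine ⟨cons a v, hv, ?_⟩
    -- The move is local and already changes a spin below a, so the siblings are untouched; if they
    -- agreed they would fix the majority.
    have hsub : ∀ b, b ≠ a → σ.sub b = τ.sub b := by
      intro b hb
      funext w
      by_contra hw
      exact hb (cons_injective (hl (show σ (cons b w) ≠ τ (cons b w) from hw)
        (show σ (cons a v) ≠ τ (cons a v) from hv))).1
    have h1 := hsub (a + 1) (by simp)
    have h2 := hsub (a + 2) (by simp)
    show pivotal r v.1 (σ.sub a) * _ = 1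
    rw [hp]
    rw [majority_succ_shift r a σ, majority_succ_shift r a τ, ← h1, ← h2] at h
    rcases majority_eq_one_or r (σ.sub (a + 1)) with h3 | h3 <;>
    rcases majority_eq_one_or r (σ.sub (a + 2)) with h4 | h4 <;>
    rw [h3, h4] at h ⊢
    · exact absurd (by ring) h
    · norm_num
    · norm_num
    · exact absurd (by ring) h

/-- The weight of the tree attached to a further vertex. -/
def treeWeight (β : ℝ) : ℕ → ℝ
  | 0 => bondWeight β
  | r + 1 => bondWeight β * treeWeight β r ^ 3

/-- The mean of the recursive majority in a tree attached to a vertex of spin `+1`. -/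
def majorityMean (θ : ℝ) : ℕ → ℝ
  | 0 => θ
  | r + 1 => θ * ((3 * majorityMean θ r - majorityMean θ r ^ 3) / 2)

lemma treeWeight_pos (β : ℝ) : ∀ r, 0 < treeWeight β r
  | 0 => bondWeight_pos β
  | r + 1 => mul_pos (bondWeight_pos β) (pow_pos (treeWeight_pos β r) 3)

lemma message_one (r : ℕ) (β : ℝ) (s : ℤˣ) :
    message 3 r β (fun _ => 1) s = treeWeight β r := by
  induction r generalizing s with
  | zero => simp only [message_zero, mul_one, sum_alpha, treeWeight]
  | succ r ih =>
    have h := message_succ_three r β 0 (fun _ => 1) (fun _ => 1) (fun _ => 1) s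
    simp only [mul_one, ih, ← Finset.sum_mul, sum_alpha] at h
    rw [h, treeWeight]
    ring

lemma spin_sq (t : ℤˣ) : ((t : ℤ) : ℝ) ^ 2 = 1 := by
  rcases Int.units_eq_one_or t with rfl | rfl <;> simp

/-- Divided by `treeWeight`, a message is a conditional expectation given the spin s of the attached
vertex. The mean of the majority is odd in s because t³ = t for spins. -/
lemma message_majority (r : ℕ) (β : ℝ) (s : ℤˣ) :
    message 3 r β (majority r) s =
      ((s : ℤ) : ℝ) * majorityMean (bondMean β) r * treeWeight β r := by
  induction r generalizing s with
  | zero =>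
    simp only [message_zero, majority, majorityMean, treeWeight, sum_alpha_mul_spin]
    ring
  | succ r ih =>
    have h0 := message_succ_three r β 0 (majority r) (fun _ => 1) (fun _ => 1) s
    have h1 := message_succ_three r β 0 (fun _ => 1) (majority r) (fun _ => 1) s
    have h2 := message_succ_three r β 0 (fun _ => 1) (fun _ => 1) (majority r) s
    have h3 := message_succ_three r β 0 (majority r) (majority r) (majority r) s
    simp only [mul_one, one_mul, zero_add, ih, message_one] at h0 h1 h2 h3
    have hF : majority (r + 1) = fun σ =>
        (majority r (σ.sub 0) + majority r (σ.sub 1) + majority r (σ.sub 2) -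
          majority r (σ.sub 0) * majority r (σ.sub 1) * majority r (σ.sub 2)) / 2 := by
      funext σ
      rw [majority]
    rw [hF, message_div, message_sub, message_add, message_add, h0, h1, h2, h3,
      ← Finset.sum_add_distrib, ← Finset.sum_add_distrib, ← Finset.sum_sub_distrib,
      majorityMean, treeWeight]
    set m := majorityMean (bondMean β) r
    set C := treeWeight β r
    have hsum : ∀ t : ℤˣ, alpha β s t * (((t : ℤ) : ℝ) * m * C * C * C) +
        alpha β s t * (C * (((t : ℤ) : ℝ) * m * C) * C) +
        alpha β s t * (C * C * (((t : ℤ) : ℝ) * m * C)) -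
        alpha β s t * (((t : ℤ) : ℝ) * m * C * (((t : ℤ) : ℝ) * m * C) *
          (((t : ℤ) : ℝ) * m * C)) =
        alpha β s t * ((t : ℤ) : ℝ) * ((3 * m - m ^ 3) * C ^ 3) := by
      intro t
      have := spin_sq t
      linear_combination (- alpha β s t * ((t : ℤ) : ℝ) * m ^ 3 * C ^ 3) * this
    simp only [hsum]
    rw [← Finset.sum_mul, sum_alpha_mul_spin]
    ring

/-- If `(1 - m²) / 2 ≤ κ` for the mean `m` of the recursive majority at every level, then each leaf
is pivotal with weight at most `κ ^ r`. -/
lemma message_pivotal_le {β κ : ℝ} (hκ : 0 ≤ κ)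
    (hm : ∀ r, (1 - majorityMean (bondMean β) r ^ 2) / 2 ≤ κ) (r : ℕ) (l : List (Fin 3)) (s : ℤˣ) :
    message 3 r β (pivotal r l) s ≤ κ ^ r * treeWeight β r := by
  induction r generalizing l s with
  | zero =>
    have : pivotal 0 l = fun _ => 1 := by funext σ; rw [pivotal]
    rw [this, message_one, pow_zero, one_mul]
  | succ r ih =>
    have hC := treeWeight_pos β r
    cases l with
    | nil =>
      have : pivotal (r + 1) [] = fun _ => 0 := by funext σ; rw [pivotal]
      rw [this]
      simp only [message, mul_zero, Finset.sum_const_zero]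
      exact mul_nonneg (pow_nonneg hκ _) (treeWeight_pos β _).le
    | cons a l =>
      have hF : pivotal (r + 1) (a :: l) = fun σ =>
          (pivotal r l (σ.sub a) * 1 * 1 - pivotal r l (σ.sub a) *
            majority r (σ.sub (a + 1)) * majority r (σ.sub (a + 2))) / 2 := by
        funext σ
        rw [pivotal]
        ring
      have h1 := message_succ_three r β a (pivotal r l) (fun _ => 1) (fun _ => 1) s
      have h2 := message_succ_three r β a (pivotal r l) (majority r) (majority r) s
      rw [hF, message_div, message_sub, h1, h2, ← Finset.sum_sub_distrib]
      simp only [message_one, message_majority]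
      set m := majorityMean (bondMean β) r with hmr
      set C := treeWeight β r
      -- Given t, both sibling majorities have mean t m, so their product has mean m² whatever t is,
      -- and disagreement has probability (1 - m²)/2.
      have hterm : ∀ t : ℤˣ, alpha β s t * (message 3 r β (pivotal r l) t * C * C) -
          alpha β s t * (message 3 r β (pivotal r l) t * (((t : ℤ) : ℝ) * m * C) *
            (((t : ℤ) : ℝ) * m * C)) ≤ alpha β s t * (2 * κ ^ (r + 1) * C ^ 3) := by
        intro t
        have h3 := spin_sq t
        have h4 : message 3 r β (pivotal r l) t * ((1 - m ^ 2) / 2) ≤ (κ ^ r * C) * κ :=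
          (mul_le_mul_of_nonneg_left (hm r) (message_nonneg (pivotal_nonneg r l) t)).trans
            (mul_le_mul_of_nonneg_right (ih l t) hκ)
        calc _ = alpha β s t * ((message 3 r β (pivotal r l) t * ((1 - m ^ 2) / 2)) *
              (2 * C ^ 2)) := by
              linear_combination
                (- alpha β s t * message 3 r β (pivotal r l) t * m ^ 2 * C ^ 2) * h3
          _ ≤ alpha β s t * (((κ ^ r * C) * κ) * (2 * C ^ 2)) :=
              mul_le_mul_of_nonneg_left (mul_le_mul_of_nonneg_right h4 (by positivity))
                (alpha_pos β s t).le
          _ = _ := by ring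
      have hle := Finset.sum_le_sum fun t (_ : t ∈ Finset.univ) => hterm t
      rw [← Finset.sum_mul, sum_alpha] at hle
      rw [treeWeight]
      linarith

/-- Summing over the spin of the attached vertex multiplies every configuration by the same
`bondWeight β`, so the Ising distribution on the tree is recovered. -/
lemma sum_isingMeasure_mul (r : ℕ) (β : ℝ) (F : Config (TreeVertex 3 r) → ℝ) :
    ∑ σ, isingMeasure (completeTree 3 r) β σ * F σ =
      (∑ s, message 3 r β F s) / (2 * treeWeight β r) := by
  have h1 := sum_message (b := 3) (r := r) (β := β) (fun _ => 1)
  simp only [message_one, mul_one, Finset.sum_const, Finset.card_univ] at h1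
  rw [show Fintype.card ℤˣ = 2 from rfl] at h1
  have hb := bondWeight_pos β
  have hpos := sum_isingWeight_pos (completeTree 3 r) β
  have h2 : 2 * treeWeight β r =
      bondWeight β * ∑ σ, isingWeight (completeTree 3 r) β σ := by
    rw [← h1]; simp
  rw [sum_message, h2, mul_div_mul_left _ _ hb.ne', Finset.sum_div]
  refine Finset.sum_congr rfl fun σ _ => ?_
  rw [isingMeasure]
  ring

lemma sum_isingMeasure_mul_majority (r : ℕ) (β : ℝ) :
    ∑ σ, isingMeasure (completeTree 3 r) β σ * majority r σ = 0 := by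
  rw [sum_isingMeasure_mul, sum_spin]
  simp [message_majority]

lemma sum_isingMeasure_mul_majority_sq (r : ℕ) (β : ℝ) :
    ∑ σ, isingMeasure (completeTree 3 r) β σ * majority r σ ^ 2 = 1 := by
  rw [← sum_isingMeasure (completeTree 3 r) β]
  refine Finset.sum_congr rfl fun σ _ => ?_
  rcases majority_eq_one_or r σ with h | h <;> rw [h] <;> ring

lemma sum_isingMeasure_mul_pivotal_le {β κ : ℝ} (hκ : 0 ≤ κ)
    (hm : ∀ r, (1 - majorityMean (bondMean β) r ^ 2) / 2 ≤ κ) (r : ℕ) (l : List (Fin 3)) :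
    ∑ σ, isingMeasure (completeTree 3 r) β σ * pivotal r l σ ≤ κ ^ r := by
  have hC := treeWeight_pos β r
  rw [sum_isingMeasure_mul, div_le_iff₀ (by positivity), sum_spin]
  have h1 := message_pivotal_le hκ hm r l 1
  have h2 := message_pivotal_le hκ hm r l (-1)
  linarith

lemma bondMean_eq {β ε : ℝ} (hε : ε = (1 + Real.exp (2 * β))⁻¹) : bondMean β = 1 - 2 * ε := by
  have h := Real.exp_pos β
  have h2 : Real.exp (2 * β) = Real.exp β ^ 2 := by rw [← Real.exp_nat_mul]; norm_num
  rw [bondMean, bondWeight, hε, h2, Real.exp_neg]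
  field_simp
  ring

/-- The bound m² ≥ 1 - 2κ is invariant under m ↦ (1 - 2ε)(3m - m³)/2: the cubic is increasing on [0,
1], and at m² = 1 - 2κ its square is (1 - 2κ)(1 + κ)², so it suffices that (1 - 2ε)(1 + κ) ≥ 1. -/
lemma majorityMean_bounds {ε : ℝ} (h0 : 0 < ε) (h1 : ε < 1 / 2) (r : ℕ) :
    0 ≤ majorityMean (1 - 2 * ε) r ∧ majorityMean (1 - 2 * ε) r ≤ 1 ∧
      1 - 2 * (2 * ε + 8 * ε ^ 2) ≤ majorityMean (1 - 2 * ε) r ^ 2 := by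
  induction r with
  | zero =>
    refine ⟨?_, ?_, ?_⟩ <;> simp only [majorityMean] <;> nlinarith
  | succ r ih =>
    obtain ⟨ih0, ih1, ih2⟩ := ih
    rw [majorityMean]
    set m := majorityMean (1 - 2 * ε) r
    have hg0 : 0 ≤ (3 * m - m ^ 3) / 2 := by nlinarith [mul_nonneg ih0 (sub_nonneg.2 ih1)]
    have hg1 : (3 * m - m ^ 3) / 2 ≤ 1 := by
      nlinarith [mul_nonneg (sq_nonneg (1 - m)) (by linarith : (0 : ℝ) ≤ m + 2)]
    refine ⟨mul_nonneg (by linarith) hg0, ?_, ?_⟩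
    · exact mul_le_one₀ (by linarith) hg0 hg1
    · set κ := 2 * ε + 8 * ε ^ 2 with hκ
      rcases le_or_gt (1 / 2) κ with h | h
      · nlinarith [sq_nonneg ((1 - 2 * ε) * ((3 * m - m ^ 3) / 2))]
      · have hε4 : ε ≤ 1 / 4 := by nlinarith [sq_nonneg ε]
        -- With κ = 2ε + cε² the second-order coefficient is c - 4; c = 8 leaves the excess 4ε²(1 -
        -- 4ε), nonnegative for ε ≤ 1/4.
        have hθ : 1 ≤ (1 - 2 * ε) * (1 + κ) := by
          have : (1 - 2 * ε) * (1 + κ) = 1 + 4 * ε ^ 2 * (1 - 4 * ε) := by rw [hκ]; ring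
          rw [this]
          nlinarith [mul_nonneg (sq_nonneg ε) (by linarith : (0 : ℝ) ≤ 1 - 4 * ε)]
        have hu1 : m ^ 2 ≤ 1 := by nlinarith
        have hmono : (1 - 2 * κ) * (1 + κ) ^ 2 ≤ ((3 * m - m ^ 3) / 2) ^ 2 := by
          have hκ0 : 0 ≤ κ := by rw [hκ]; positivity
          -- This factorization expresses the monotonicity of u ↦ u(3 - u)²/4 at u = m², written in
          -- 1 - u and 2κ to make every term nonnegative.
          have hfac : ((3 * m - m ^ 3) / 2) ^ 2 - (1 - 2 * κ) * (1 + κ) ^ 2 =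
              (m ^ 2 - (1 - 2 * κ)) * (3 * (1 - m ^ 2) + 3 * (2 * κ) + (1 - m ^ 2) ^ 2 +
                (1 - m ^ 2) * (2 * κ) + (2 * κ) ^ 2) / 4 := by ring
          have hu : 0 ≤ 1 - m ^ 2 := by linarith
          have hs : 0 ≤ m ^ 2 - (1 - 2 * κ) := by linarith
          rw [← sub_nonneg, hfac]
          positivity
        have hθ0 : (0 : ℝ) ≤ 1 - 2 * ε := by linarith
        calc 1 - 2 * κ = (1 - 2 * κ) * 1 ^ 2 := by ring
          _ ≤ (1 - 2 * κ) * ((1 - 2 * ε) * (1 + κ)) ^ 2 :=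
              mul_le_mul_of_nonneg_left (pow_le_pow_left₀ zero_le_one hθ 2) (by linarith)
          _ = (1 - 2 * ε) ^ 2 * ((1 - 2 * κ) * (1 + κ) ^ 2) := by ring
          _ ≤ (1 - 2 * ε) ^ 2 * ((3 * m - m ^ 3) / 2) ^ 2 :=
              mul_le_mul_of_nonneg_left hmono (sq_nonneg _)
          _ = _ := by ring

end Majority

/-! ### Dirichlet forms of the majority and relaxation times. -/

section Bounds

open TreeVertex

variable {β κ : ℝ}

lemma localMove_update {V : Type*} [DecidableEq V] (σ : Config V) (v : V) (a : ℤˣ) :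
    LocalMove σ (Function.update σ v a) := by
  have : ∀ w, σ w ≠ Function.update σ v a w → w = v := by
    intro w hw
    by_contra hne
    exact hw (Function.update_of_ne hne _ _).symm
  intro x hx y hy
  rw [this x hx, this y hy]

lemma majority_sub_sq_le (r : ℕ) (σ τ : Config (TreeVertex 3 r)) :
    (majority r σ - majority r τ) ^ 2 ≤ 4 := by
  rcases majority_eq_one_or r σ with h | h <;> rcases majority_eq_one_or r τ with h' | h' <;>
  rw [h, h'] <;> norm_num

/-- The rows of P may depend on the whole configuration and concentrate on pivotal flips, so only
their total mass is controlled; the union bound over vertices gives the factor n_r. -/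
lemma dirichletForm_majority_le (hκ : 0 ≤ κ)
    (hm : ∀ r, (1 - majorityMean (bondMean β) r ^ 2) / 2 ≤ κ) (r : ℕ)
    {P : Matrix (Config (TreeVertex 3 r)) (Config (TreeVertex 3 r)) ℝ}
    (hP : IsFeasible LocalMove (isingMeasure (completeTree 3 r) β) P) :
    dirichletForm (isingMeasure (completeTree 3 r) β) P (majority r) ≤
      2 * (Fintype.card (TreeVertex 3 r) * κ ^ r) := by
  have hterm : ∀ σ τ, P σ τ * (majority r σ - majority r τ) ^ 2 ≤
      P σ τ * (4 * ∑ v : TreeVertex 3 r, pivotal r v.1 σ) := by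
    intro σ τ
    by_cases hl : LocalMove σ τ
    · refine mul_le_mul_of_nonneg_left ?_ (hP.nonneg σ τ)
      have hnn : 0 ≤ ∑ v : TreeVertex 3 r, pivotal r v.1 σ :=
        Finset.sum_nonneg fun v _ => pivotal_nonneg r v.1 σ
      by_cases h : majority r σ = majority r τ
      · rw [h, sub_self]
        linarith
      · obtain ⟨v, -, hv⟩ := exists_pivotal_of_majority_ne r hl h
        have h1 : pivotal r v.1 σ ≤ ∑ v : TreeVertex 3 r, pivotal r v.1 σ :=
          Finset.single_le_sum (f := fun v : TreeVertex 3 r => pivotal r v.1 σ)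
            (fun v _ => pivotal_nonneg r v.1 σ) (Finset.mem_univ v)
        linarith [majority_sub_sq_le r σ τ]
    · rw [hP.support σ τ hl, zero_mul, zero_mul]
  have hrow : ∀ σ, ∑ τ, isingMeasure (completeTree 3 r) β σ * P σ τ *
      (majority r σ - majority r τ) ^ 2 ≤
      4 * ∑ v : TreeVertex 3 r, isingMeasure (completeTree 3 r) β σ * pivotal r v.1 σ := by
    intro σ
    have h := Finset.sum_le_sum fun τ (_ : τ ∈ Finset.univ) => hterm σ τ
    rw [← Finset.sum_mul, hP.row_sum, one_mul] at h
    simp only [mul_assoc]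
    rw [← Finset.mul_sum, ← Finset.mul_sum, mul_left_comm]
    exact mul_le_mul_of_nonneg_left h (isingMeasure_pos _ β σ).le
  calc _ ≤ 1 / 2 * ∑ σ, 4 * ∑ v : TreeVertex 3 r,
          isingMeasure (completeTree 3 r) β σ * pivotal r v.1 σ :=
        mul_le_mul_of_nonneg_left (Finset.sum_le_sum fun σ _ => hrow σ) (by norm_num)
    _ = 2 * ∑ v : TreeVertex 3 r, ∑ σ,
          isingMeasure (completeTree 3 r) β σ * pivotal r v.1 σ := by
        rw [← Finset.mul_sum, Finset.sum_comm]
        ring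
    _ ≤ 2 * ∑ _v : TreeVertex 3 r, κ ^ r :=
        mul_le_mul_of_nonneg_left (Finset.sum_le_sum fun v _ =>
          sum_isingMeasure_mul_pivotal_le hκ hm r v.1) (by norm_num)
    _ = _ := by rw [Finset.sum_const, Finset.card_univ, nsmul_eq_mul]

/-- The rates do not depend on σ, so the pivotal probabilities are averaged over v rather than
summed, and no factor n_r appears. -/
lemma dirichletForm_glauber_majority_le (hκ : 0 ≤ κ)
    (hm : ∀ r, (1 - majorityMean (bondMean β) r ^ 2) / 2 ≤ κ) (r : ℕ)
    {ρ : TreeVertex 3 r → ℝ} (hρ : ∀ v, 0 ≤ ρ v) (hsum : ∑ v, ρ v = 1) :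
    dirichletForm (isingMeasure (completeTree 3 r) β) (glauber (completeTree 3 r) β ρ)
      (majority r) ≤ 2 * κ ^ r := by
  have hrow : ∀ σ, ∑ τ, glauber (completeTree 3 r) β ρ σ τ *
      (majority r σ - majority r τ) ^ 2 ≤ ∑ v, ρ v * (4 * pivotal r v.1 σ) := by
    intro σ
    rw [sum_glauber_mul]
    refine Finset.sum_le_sum fun v _ => mul_le_mul_of_nonneg_left ?_ (hρ v)
    rw [← one_mul (4 * pivotal r v.1 σ), ← sum_heatBath (completeTree 3 r) β σ v, Finset.sum_mul]
    refine Finset.sum_le_sum fun a _ =>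
      mul_le_mul_of_nonneg_left ?_ (heatBath_pos (completeTree 3 r) β σ v a).le
    by_cases h : majority r σ = majority r (Function.update σ v a)
    · rw [← h, sub_self]
      linarith [pivotal_nonneg r v.1 σ]
    · obtain ⟨w, hw, hp⟩ := exists_pivotal_of_majority_ne r (localMove_update σ v a) h
      obtain rfl : w = v := by
        by_contra hne
        exact hw (Function.update_of_ne hne _ _).symm
      rw [hp]
      linarith [majority_sub_sq_le r σ (Function.update σ w a)]
  calc _ = 1 / 2 * ∑ σ, isingMeasure (completeTree 3 r) β σ *
          ∑ τ, glauber (completeTree 3 r) β ρ σ τ * (majority r σ - majority r τ) ^ 2 := by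
        simp only [dirichletForm, Finset.mul_sum, mul_assoc]
    _ ≤ 1 / 2 * ∑ σ, isingMeasure (completeTree 3 r) β σ * ∑ v, ρ v * (4 * pivotal r v.1 σ) :=
        mul_le_mul_of_nonneg_left (Finset.sum_le_sum fun σ _ =>
          mul_le_mul_of_nonneg_left (hrow σ) (isingMeasure_pos _ β σ).le) (by norm_num)
    _ = 2 * ∑ v, ρ v * ∑ σ, isingMeasure (completeTree 3 r) β σ * pivotal r v.1 σ := by
        simp only [Finset.mul_sum]
        rw [Finset.sum_comm]
        exact Finset.sum_congr rfl fun v _ => Finset.sum_congr rfl fun σ _ => by ring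
    _ ≤ 2 * ∑ v, ρ v * κ ^ r :=
        mul_le_mul_of_nonneg_left (Finset.sum_le_sum fun v _ => mul_le_mul_of_nonneg_left
          (sum_isingMeasure_mul_pivotal_le hκ hm r v.1) (hρ v)) (by norm_num)
    _ = _ := by rw [← Finset.sum_mul, hsum, one_mul]

lemma one_sub_le_lambda2 (r : ℕ)
    {P : Matrix (Config (TreeVertex 3 r)) (Config (TreeVertex 3 r)) ℝ}
    (hP : IsFeasible LocalMove (isingMeasure (completeTree 3 r) β) P) :
    1 - dirichletForm (isingMeasure (completeTree 3 r) β) P (majority r) ≤ lambda2 P := by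
  have : Nontrivial ℤˣ := ⟨1, -1, by decide⟩
  have : Nonempty (TreeVertex 3 r) := ⟨root 3 r⟩
  exact one_sub_dirichletForm_le_lambda2 (isingMeasure_pos _ β) hP.nonneg hP.detailed_balance
    hP.row_sum Fintype.one_lt_card _ (sum_isingMeasure_mul_majority r β)
    (sum_isingMeasure_mul_majority_sq r β)

lemma uniform_rate_pos (r : ℕ) :
    0 < 1 / (Fintype.card (TreeVertex 3 r) : ℝ) := by
  have : Nonempty (TreeVertex 3 r) := ⟨root 3 r⟩
  have : 0 < Fintype.card (TreeVertex 3 r) := Fintype.card_pos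
  positivity

lemma sum_uniform_rate (r : ℕ) :
    ∑ _v : TreeVertex 3 r, 1 / (Fintype.card (TreeVertex 3 r) : ℝ) = 1 := by
  have := (one_div_pos.1 (uniform_rate_pos r)).ne'
  rw [Finset.sum_const, Finset.card_univ, nsmul_eq_mul, mul_one_div_cancel this]

lemma isFeasible_uniformGlauber (r : ℕ) (β : ℝ) :
    IsFeasible LocalMove (isingMeasure (completeTree 3 r) β)
      (uniformGlauber (completeTree 3 r) β) :=
  isFeasible_glauber _ β (fun _ => (uniform_rate_pos r).le) (sum_uniform_rate r)

lemma lambda2_uniformGlauber_lt_one (r : ℕ) (β : ℝ) :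
    lambda2 (uniformGlauber (completeTree 3 r) β) < 1 :=
  have : Nonempty (TreeVertex 3 r) := ⟨root 3 r⟩
  lambda2_glauber_lt_one _ β (fun _ => uniform_rate_pos r) (sum_uniform_rate r)

lemma le_tau2Star (hκ : 0 ≤ κ)
    (hm : ∀ r, (1 - majorityMean (bondMean β) r ^ 2) / 2 ≤ κ) (r : ℕ) :
    1 / (2 * (Fintype.card (TreeVertex 3 r) * κ ^ r)) ≤
      tau2Star LocalMove (isingMeasure (completeTree 3 r) β) := by
  have hlow : ∀ x ∈ lambda2 '' {P | IsFeasible LocalMove (isingMeasure (completeTree 3 r) β) P},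
      1 - 2 * (Fintype.card (TreeVertex 3 r) * κ ^ r) ≤ x := by
    rintro _ ⟨P, hP, rfl⟩
    have h1 := one_sub_le_lambda2 r hP
    have h2 := dirichletForm_majority_le hκ hm r hP
    linarith
  have hmem : lambda2 (uniformGlauber (completeTree 3 r) β) ∈
      lambda2 '' {P | IsFeasible LocalMove (isingMeasure (completeTree 3 r) β) P} :=
    ⟨_, isFeasible_uniformGlauber r β, rfl⟩
  -- Uniform Glauber witnesses λ₂⋆ < 1; `hlow` supplies the lower bound that makes the infimum
  -- meaningful.
  have h1 : lambda2Star LocalMove (isingMeasure (completeTree 3 r) β) < 1 :=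
    (csInf_le ⟨_, hlow⟩ hmem).trans_lt (lambda2_uniformGlauber_lt_one r β)
  have h2 : 1 - 2 * (Fintype.card (TreeVertex 3 r) * κ ^ r) ≤
      lambda2Star LocalMove (isingMeasure (completeTree 3 r) β) := le_csInf ⟨_, hmem⟩ hlow
  exact one_div_le_one_div_of_le (by linarith) (by linarith)

lemma le_tau2_uniformGlauber (hκ : 0 ≤ κ)
    (hm : ∀ r, (1 - majorityMean (bondMean β) r ^ 2) / 2 ≤ κ) (r : ℕ) :
    1 / (2 * κ ^ r) ≤ tau2 (uniformGlauber (completeTree 3 r) β) := by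
  have h1 := one_sub_le_lambda2 r (isFeasible_uniformGlauber r β)
  have h2 := dirichletForm_glauber_majority_le hκ hm r
    (fun _ => (uniform_rate_pos r).le) (sum_uniform_rate r)
  have h3 := lambda2_uniformGlauber_lt_one r β
  rw [← uniformGlauber] at h2
  exact one_div_le_one_div_of_le (by linarith) (by linarith)

/-- Here 1 ≤ n_r / 3^r ≤ 3/2, while κ^r is the power log₃ κ of 3^r. As κ may exceed 1, the sign of
log₃ κ is unknown, hence the absolute value. -/
lemma card_rpow_mul_pow_le (hκ : 0 < κ) (r : ℕ) :
    (Fintype.card (TreeVertex 3 r) : ℝ) ^ (-Real.logb 3 κ) * κ ^ r ≤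
      (3 / 2 : ℝ) ^ |Real.logb 3 κ| := by
  set n : ℝ := (Fintype.card (TreeVertex 3 r) : ℝ) with hn
  have hcard : 2 * n + 1 = 3 ^ (r + 1) := by
    rw [hn]
    exact_mod_cast two_mul_card_add_one r
  have h3 : (1 : ℝ) ≤ 3 ^ r := one_le_pow₀ (by norm_num)
  have h3' : (0 : ℝ) < 3 ^ r := by positivity
  rw [pow_succ] at hcard
  have hn0 : 0 < n := by linarith
  have hx1 : 1 ≤ n / 3 ^ r := by rw [le_div_iff₀ h3']; linarith
  have hx2 : n / 3 ^ r ≤ 3 / 2 := by rw [div_le_iff₀ h3']; linarith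
  have hpow : κ ^ r = ((3 : ℝ) ^ r) ^ Real.logb 3 κ := by
    rw [← Real.rpow_natCast 3 r, ← Real.rpow_mul (by norm_num), mul_comm, Real.rpow_mul (by norm_num),
      Real.rpow_logb (by norm_num) (by norm_num) hκ, Real.rpow_natCast]
  have heq : n ^ (-Real.logb 3 κ) * κ ^ r = (n / 3 ^ r) ^ (-Real.logb 3 κ) := by
    rw [Real.div_rpow hn0.le h3'.le, Real.rpow_neg h3'.le, div_inv_eq_mul, hpow]
  rw [heq]
  exact (Real.rpow_le_rpow_of_exponent_le hx1 (neg_le_abs _)).trans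
    (Real.rpow_le_rpow (by linarith) hx2 (abs_nonneg _))

end Bounds

end FastestMixing

end

theorem proposition6 (β : ℝ) (hβ : 0 < β) (ε : ℝ) (hε : ε = (1 + Real.exp (2 * β))⁻¹) :
    (∃ c : ℝ, 0 < c ∧ ∀ᶠ r : ℕ in Filter.atTop,
      c * (Fintype.card (FastestMixing.TreeVertex 3 r) : ℝ) ^
          (-Real.logb 3 (2 * ε + 8 * ε ^ 2) - 1) ≤
        FastestMixing.tau2Star FastestMixing.LocalMove
          (FastestMixing.isingMeasure (FastestMixing.completeTree 3 r) β)) ∧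
    (∃ c : ℝ, 0 < c ∧ ∀ᶠ r : ℕ in Filter.atTop,
      c * (Fintype.card (FastestMixing.TreeVertex 3 r) : ℝ) ^
          (-Real.logb 3 (2 * ε + 8 * ε ^ 2)) ≤
        FastestMixing.tau2
          (FastestMixing.uniformGlauber (FastestMixing.completeTree 3 r) β)) := by
  have hε0 : 0 < ε := by rw [hε]; positivity
  have hε1 : ε < 1 / 2 := by
    have h := Real.one_lt_exp_iff.2 (by linarith : 0 < 2 * β)
    rw [hε, one_div]
    exact inv_strictAnti₀ two_pos (by linarith)
  set κ := 2 * ε + 8 * ε ^ 2 with hκdef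
  have hκ : 0 < κ := by positivity
  have hm : ∀ r, (1 - FastestMixing.majorityMean (FastestMixing.bondMean β) r ^ 2) / 2 ≤ κ := by
    intro r
    rw [FastestMixing.bondMean_eq hε]
    have := (FastestMixing.majorityMean_bounds hε0 hε1 r).2.2
    linarith
  set D : ℝ := (3 / 2 : ℝ) ^ |Real.logb 3 κ| with hD
  have hD0 : 0 < D := by positivity
  have hcard : ∀ r, 0 < (Fintype.card (FastestMixing.TreeVertex 3 r) : ℝ) := fun r =>
    one_div_pos.1 (FastestMixing.uniform_rate_pos r)
  -- The 2 comes from the Dirichlet form bounds and D from comparing n_r with 3^r; both estimates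
  -- hold for every r.
  refine ⟨⟨1 / (2 * D), by positivity, Filter.Eventually.of_forall fun r => ?_⟩,
    ⟨1 / (2 * D), by positivity, Filter.Eventually.of_forall fun r => ?_⟩⟩
  · refine le_trans ?_ (FastestMixing.le_tau2Star hκ.le hm r)
    have h := FastestMixing.card_rpow_mul_pow_le hκ r
    have hn := hcard r
    rw [Real.rpow_sub_one hn.ne', div_mul_eq_mul_div, one_mul, div_div,
      div_le_div_iff₀ (by positivity) (by positivity)]
    calc _ = 2 * (Fintype.card (FastestMixing.TreeVertex 3 r) : ℝ) *
          ((Fintype.card (FastestMixing.TreeVertex 3 r) : ℝ) ^ (-Real.logb 3 κ) * κ ^ r) := by ring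
      _ ≤ 2 * (Fintype.card (FastestMixing.TreeVertex 3 r) : ℝ) * D :=
          mul_le_mul_of_nonneg_left h (by positivity)
      _ = _ := by ring
  · refine le_trans ?_ (FastestMixing.le_tau2_uniformGlauber hκ.le hm r)
    have h := FastestMixing.card_rpow_mul_pow_le hκ r
    rw [div_mul_eq_mul_div, one_mul, div_le_div_iff₀ (by positivity) (by positivity)]
    linarith
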